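/- Let $f(z)=\sum_{k=0}^\infty a_k z^k$ be analytic in the unit disk $\mathbb D=\{z\in\mathbb C:|z|<1\}$ with $|f(z)|\le 1$ in $\mathbb D$, and for $0\le r<1$ let $S_r=S_r(f)$ denote the area of the image of the subdisk $\{|z|<r\}$ under $f$. Then $$B_1(r):=\sum_{k=0}^\infty |a_k|r^k+\frac{16}{9}\,\frac{S_r}{\pi}\le 1\qquad\text{for } 0\le r\le \tfrac13,$$ and the numbers $1/3$ and $16/9$ cannot be improved: for every $r\in(1/3,1)$ there is such an $f$ with $B_1(r)>1$, and for every $c>16/9$ there is such an $f$ for which $\sum_{k=0}^\infty|a_k|r^k+c\,S_r/\pi>1$ at $r=1/3$. Moreover, $$B_2(r):=|a_0|^2+\sum_{k=1}^\infty |a_k|r^k+\frac{9}{8}\,\frac{S_r}{\pi}\le 1\qquad\text{for } 0\le r\le \tfrac12,$$ and the numbers $1/2$ and $9/8$ cannot be improved: for every $r\in(1/2,1)$ there is such an $f$ with $B_2(r)>1$, and for every $c>9/8$ there is such an $f$ for which $|a_0|^2+\sum_{k=1}^\infty|a_k|r^k+c\,S_r/\pi>1$ at $r=1/2$. All of this holds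 both when $S_r$ is the Lebesgue measure of the set $f(\{|z|<r\})$ and when the area is counted with multiplicity, i.e. $S_r=\iint_{|z|<r}|f'(z)|^2\,dx\,dy$. -/

import Mathlib

open MeasureTheory
open scoped ENNReal

noncomputable section

/-- `f` is analytic in the open unit disk with Taylor expansion `f z = ∑ a k * z ^ k` there,
and `|f| ≤ 1` in the disk. -/
structure IsBoundedAnalytic (f : ℂ → ℂ) (a : ℕ → ℂ) : Prop where
  analytic : AnalyticOnNhd ℂ f (Metric.ball 0 1)
  hasSum : ∀ z ∈ Metric.ball (0 : ℂ) 1, HasSum (fun k : ℕ => a k * z ^ k) (f z)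
  norm_le_one : ∀ z ∈ Metric.ball (0 : ℂ) 1, ‖f z‖ ≤ 1

/-- The area (planar Lebesgue measure) of the set `f({|z| < r})`. -/
def imageArea (f : ℂ → ℂ) (r : ℝ) : ℝ≥0∞ :=
  volume (f '' Metric.ball (0 : ℂ) r)

/-- The area of the image of `{|z| < r}` under `f`, counted with multiplicity:
the integral of `|f'|²` over `{|z| < r}`. -/
def multiplicityArea (f : ℂ → ℂ) (r : ℝ) : ℝ≥0∞ :=
  ∫⁻ z in Metric.ball (0 : ℂ) r, ‖deriv f z‖ₑ ^ 2

end

/-!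
The extremal functions are the disc automorphisms `(b - z) / (1 - b * z)`, whose coefficients after
the constant term `b` have modulus `(1 - b ^ 2) * b ^ k`. The proof compares a bounded function `f`
with the automorphism for which `b = ‖f 0‖`.

The comparison is Rogosinski's inequality: for every `n`, the sum of `‖a (k + 1)‖ ^ 2` over `k < n`
is at most the same sum for the automorphism
(`IsBoundedAnalytic.sum_norm_sq_le_sum_automorphism`). Write
`f - f 0 = w * (1 - conj (f 0) * f)` with `‖w‖ ≤ 1` and `w 0 = 0`. Multiplication by `w` does not
increase the `ℓ²`-norm of the coefficients (`sum_norm_sq_mul_polynomial_le`, from Parseval's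
identity on circles), and since `w 0 = 0` the coefficients of `f` up to order `n` depend only on
those of `1 - conj (f 0) * f` up to order `n - 1`; this gives a recursion in `n`.

Summation by parts extends the comparison to nonincreasing weights. In polar coordinates the area
counted with multiplicity is `π ∑ k ‖a k‖ ^ 2 r ^ (2 * k)`, and its weights are nonincreasing when
`r ^ 2 ≤ 1 / 2`, so the automorphism has the largest area (`IsBoundedAnalytic.multiplicityArea_le`).
The sum of `‖a k‖ * r ^ k` is reduced to weighted sums of `‖a k‖ ^ 2` by the arithmetic–geometric
mean inequality, tuned to be an equality for the automorphism when `r ≤ b`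
(`IsBoundedAnalytic.sum_norm_mul_pow_le_of_le`), and treated more crudely when `b < r`
(`IsBoundedAnalytic.sum_norm_mul_pow_le`). Both quantities increase with `r`, so only `r = 1 / 3`
and `r = 1 / 2` matter, where a polynomial inequality in `b` remains.

The area of the image as a set is at most the area with multiplicity, with equality for injective
maps such as the automorphisms. These therefore show sharpness for both areas, as `b → 1`.
-/

/-! ### Parseval's identity on circles -/

theorem integral_exp_int_mul_I (n : ℤ) :
    ∫ θ in Set.Ioo (-Real.pi) Real.pi, Complex.exp (n * θ * Complex.I) =
      if n = 0 then 2 * (Real.pi : ℂ) else 0 := by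
  rw [← integral_Ioc_eq_integral_Ioo,
    ← intervalIntegral.integral_of_le (by linarith [Real.pi_pos])]
  split_ifs with h
  · subst h
    simp
    ring
  · have hc : (n : ℂ) * Complex.I ≠ 0 :=
      mul_ne_zero (Int.cast_ne_zero.mpr h) Complex.I_ne_zero
    have h1 := integral_exp_mul_complex (a := -Real.pi) (b := Real.pi) hc
    have h2 : Complex.exp (n * Complex.I * (Real.pi : ℝ)) =
        Complex.exp (n * Complex.I * ((-Real.pi : ℝ) : ℂ)) := by
      rw [Complex.exp_eq_exp_iff_exists_int]
      exact ⟨n, by push_cast; ring⟩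
    rw [h2, sub_self, zero_div] at h1
    rw [← h1]
    congr 1
    ext θ
    ring_nf

theorem hasSum_norm_sq_circle {u : ℕ → ℂ} (hu : Summable u) :
    HasSum (fun k => 2 * Real.pi * ‖u k‖ ^ 2)
      (∫ θ in Set.Ioo (-Real.pi) Real.pi,
        ‖∑' k, u k * Complex.exp (θ * Complex.I) ^ k‖ ^ 2) := by
  have hun : Summable fun k => ‖u k‖ := summable_norm_iff.mpr hu
  set F : ℕ × ℕ → ℝ → ℂ := fun p θ => (u p.1 * Complex.exp (θ * Complex.I) ^ p.1) *
    (starRingEnd ℂ) (u p.2 * Complex.exp (θ * Complex.I) ^ p.2) with hF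
  have hnorm : ∀ p θ, ‖F p θ‖ = ‖u p.1‖ * ‖u p.2‖ := by
    intro p θ
    simp [hF, Complex.norm_exp_ofReal_mul_I]
  have hFexp : ∀ p θ, F p θ = u p.1 * (starRingEnd ℂ) (u p.2) *
      Complex.exp (((p.1 : ℤ) - (p.2 : ℤ) : ℤ) * θ * Complex.I) := by
    intro p θ
    simp only [hF, map_mul, map_natCast, ← Complex.exp_conj, ← Complex.exp_nat_mul,
      Complex.conj_ofReal, Complex.conj_I]
    rw [show ((((p.1 : ℤ) - (p.2 : ℤ) : ℤ) : ℂ) * θ * Complex.I) =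
      (p.1 : ℂ) * (θ * Complex.I) + (p.2 : ℂ) * (θ * -Complex.I) by push_cast; ring,
      Complex.exp_add]
    ring
  have hcont : ∀ p, Continuous (F p) := by
    intro p
    simp only [hF]
    fun_prop
  have hint : ∀ p, Integrable (F p) (volume.restrict (Set.Ioo (-Real.pi) Real.pi)) := fun p =>
    ((hcont p).continuousOn.integrableOn_Icc (a := -Real.pi) (b := Real.pi)).mono_set
      Set.Ioo_subset_Icc_self
  have hprod : Summable fun p : ℕ × ℕ => ‖u p.1‖ * ‖u p.2‖ :=
    hun.mul_of_nonneg hun (fun _ => norm_nonneg _) (fun _ => norm_nonneg _)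
  have hsum := hasSum_integral_of_summable_integral_norm hint (by
    simp only [hnorm, integral_const]
    simpa using hprod.mul_left _)
  have hval : ∀ p : ℕ × ℕ, ∫ θ in Set.Ioo (-Real.pi) Real.pi, F p θ =
      u p.1 * (starRingEnd ℂ) (u p.2) *
        (if (p.1 : ℤ) - (p.2 : ℤ) = 0 then 2 * (Real.pi : ℂ) else 0) := by
    intro p
    simp only [hFexp]
    rw [integral_const_mul, integral_exp_int_mul_I]
  simp only [hval] at hsum
  have hinj : Function.Injective fun k : ℕ => (k, k) := fun a b h => (Prod.ext_iff.mp h).1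
  rw [← hinj.hasSum_iff] at hsum
  · have htsum : ∀ θ : ℝ, ∑' p, F p θ =
        ((‖∑' k, u k * Complex.exp (θ * Complex.I) ^ k‖ ^ 2 : ℝ) : ℂ) := by
      intro θ
      have hs : Summable fun k => ‖u k * Complex.exp (θ * Complex.I) ^ k‖ := by
        simpa [Complex.norm_exp_ofReal_mul_I] using hun
      have hs' : Summable fun k =>
          ‖(starRingEnd ℂ) (u k * Complex.exp (θ * Complex.I) ^ k)‖ := by
        simpa only [RCLike.norm_conj] using hs
      rw [← tsum_mul_tsum_of_summable_norm hs hs', ← Complex.conj_tsum, Complex.mul_conj,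
        Complex.normSq_eq_norm_sq]
    simp only [htsum, integral_complex_ofReal] at hsum
    rw [← Complex.hasSum_ofReal]
    convert! hsum using 1
    ext k
    simp only [Function.comp, sub_self, if_true, Complex.mul_conj, Complex.normSq_eq_norm_sq]
    push_cast
    ring
  · rintro ⟨i, j⟩ hij
    have : i ≠ j := fun h => hij ⟨i, by simp [h]⟩
    rw [if_neg (by omega), mul_zero]

section PowerSeries

variable {h : ℂ → ℂ} {c : ℕ → ℂ}

theorem circle_mem_ball {ρ : ℝ} (h0 : 0 ≤ ρ) (h1 : ρ < 1) (θ : ℝ) :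
    (ρ : ℂ) * Complex.exp (θ * Complex.I) ∈ Metric.ball (0 : ℂ) 1 := by
  simp [Complex.norm_exp_ofReal_mul_I, abs_of_nonneg h0, h1]

/-- Parseval's identity for a power series on the circle of radius `ρ < 1`. -/
theorem hasSum_norm_sq_powerSeries
    (hc : ∀ z ∈ Metric.ball (0 : ℂ) 1, HasSum (fun k : ℕ => c k * z ^ k) (h z))
    {ρ : ℝ} (h0 : 0 ≤ ρ) (h1 : ρ < 1) :
    HasSum (fun k => 2 * Real.pi * (‖c k‖ ^ 2 * ρ ^ (2 * k)))
      (∫ θ in Set.Ioo (-Real.pi) Real.pi, ‖h (ρ * Complex.exp (θ * Complex.I))‖ ^ 2) := by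
  have hs : Summable fun k => c k * (ρ : ℂ) ^ k :=
    (hc ρ (by simpa [abs_of_nonneg h0] using h1)).summable
  have key := hasSum_norm_sq_circle hs
  have hh : ∀ θ : ℝ, ∑' k, c k * (ρ : ℂ) ^ k * Complex.exp (θ * Complex.I) ^ k =
      h (ρ * Complex.exp (θ * Complex.I)) := by
    intro θ
    rw [← (hc _ (circle_mem_ball h0 h1 θ)).tsum_eq]
    simp only [mul_pow, mul_assoc]
  simp only [hh] at key
  convert! key using 1
  ext k
  rw [norm_mul, norm_pow, Complex.norm_real, Real.norm_of_nonneg h0]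
  ring

theorem integrableOn_norm_sq_circle (hd : ContinuousOn h (Metric.ball 0 1))
    {ρ : ℝ} (h0 : 0 ≤ ρ) (h1 : ρ < 1) :
    IntegrableOn (fun θ : ℝ => ‖h (ρ * Complex.exp (θ * Complex.I))‖ ^ 2)
      (Set.Ioo (-Real.pi) Real.pi) := by
  have : Continuous fun θ : ℝ => ‖h (ρ * Complex.exp (θ * Complex.I))‖ ^ 2 :=
    ((hd.comp_continuous (by fun_prop) (circle_mem_ball h0 h1)).norm).pow 2
  exact (this.continuousOn.integrableOn_Icc).mono_set Set.Ioo_subset_Icc_self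

/-- A power series that vanishes in the unit disc has zero coefficients. -/
theorem coeff_eq_zero_of_hasSum_zero
    (hc : ∀ z ∈ Metric.ball (0 : ℂ) 1, HasSum (fun k : ℕ => c k * z ^ k) 0) (k : ℕ) :
    c k = 0 := by
  have key := hasSum_norm_sq_powerSeries (h := fun _ => 0) hc
    (ρ := 1 / 2) (by norm_num) (by norm_num)
  simp only [norm_zero, ne_eq, OfNat.ofNat_ne_zero, not_false_eq_true, zero_pow,
    integral_zero] at key
  rw [hasSum_zero_iff_of_nonneg (fun k => by positivity)] at key
  have := congrFun key k
  simpa [Real.pi_ne_zero] using this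

theorem coeff_unique {c' : ℕ → ℂ}
    (hc : ∀ z ∈ Metric.ball (0 : ℂ) 1, HasSum (fun k : ℕ => c k * z ^ k) (h z))
    (hc' : ∀ z ∈ Metric.ball (0 : ℂ) 1, HasSum (fun k : ℕ => c' k * z ^ k) (h z)) :
    c = c' := by
  ext k
  rw [← sub_eq_zero]
  refine coeff_eq_zero_of_hasSum_zero (c := fun k => c k - c' k) (fun z hz => ?_) k
  simpa [sub_mul] using (hc z hz).sub (hc' z hz)

theorem hasSum_antidiagonal {g : ℂ → ℂ} {b : ℕ → ℂ}
    (hc : ∀ z ∈ Metric.ball (0 : ℂ) 1, HasSum (fun k : ℕ => c k * z ^ k) (h z))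
    (hb : ∀ z ∈ Metric.ball (0 : ℂ) 1, HasSum (fun k : ℕ => b k * z ^ k) (g z)) :
    ∀ z ∈ Metric.ball (0 : ℂ) 1, HasSum
      (fun k : ℕ => (∑ p ∈ Finset.HasAntidiagonal.antidiagonal k, c p.1 * b p.2) * z ^ k) (h z * g z) := by
  intro z hz
  have h1 := summable_norm_iff.mpr (hc z hz).summable
  have h2 := summable_norm_iff.mpr (hb z hz).summable
  have e : ∀ k : ℕ, (∑ p ∈ Finset.HasAntidiagonal.antidiagonal k, c p.1 * b p.2) * z ^ k =
      ∑ p ∈ Finset.HasAntidiagonal.antidiagonal k, c p.1 * z ^ p.1 * (b p.2 * z ^ p.2) := by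
    intro k
    rw [Finset.sum_mul]
    refine Finset.sum_congr rfl fun p hp => ?_
    rw [← Finset.HasAntidiagonal.mem_antidiagonal.mp hp, pow_add]
    ring
  have h3 := tsum_mul_tsum_eq_tsum_sum_antidiagonal_of_summable_norm h1 h2
  have h4 := (summable_norm_sum_mul_antidiagonal_of_summable_norm h1 h2).of_norm
  rw [(hc z hz).tsum_eq, (hb z hz).tsum_eq] at h3
  rw [h3, funext e]
  exact h4.hasSum

/-! ### Multiplication by a function bounded by one -/

/-- Multiplication by a function bounded by one does not increase the `ℓ²`-norm of the
coefficients of a polynomial. -/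
theorem sum_norm_sq_mul_polynomial_le {w : ℂ → ℂ}
    (hc : ∀ z ∈ Metric.ball (0 : ℂ) 1, HasSum (fun k : ℕ => c k * z ^ k) (w z))
    (hd : ContinuousOn w (Metric.ball 0 1))
    (hw : ∀ z ∈ Metric.ball (0 : ℂ) 1, ‖w z‖ ≤ 1) {p : ℕ → ℂ} {n : ℕ}
    (hp : ∀ k, n ≤ k → p k = 0) (N : ℕ) :
    ∑ k ∈ Finset.range N, ‖∑ q ∈ Finset.HasAntidiagonal.antidiagonal k, c q.1 * p q.2‖ ^ 2 ≤
      ∑ k ∈ Finset.range n, ‖p k‖ ^ 2 := by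
  set P : ℂ → ℂ := fun z => ∑ k ∈ Finset.range n, p k * z ^ k with hP
  have hPc : Continuous P := by
    simp only [hP]
    fun_prop
  have hPs : ∀ z ∈ Metric.ball (0 : ℂ) 1, HasSum (fun k : ℕ => p k * z ^ k) (P z) :=
    fun z _ => hasSum_sum_of_ne_finset_zero fun k hk => by
      rw [hp k (by simpa using hk), zero_mul]
  set q : ℕ → ℂ := fun k => ∑ q ∈ Finset.HasAntidiagonal.antidiagonal k, c q.1 * p q.2 with hq
  have hqs := hasSum_antidiagonal hc hPs
  have hR : ∀ ρ ∈ Set.Ioo (0 : ℝ) 1, ∑ k ∈ Finset.range N, ‖q k‖ ^ 2 * ρ ^ (2 * k) ≤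
      ∑ k ∈ Finset.range n, ‖p k‖ ^ 2 := by
    rintro ρ ⟨h0, h1⟩
    have A := hasSum_norm_sq_powerSeries hqs h0.le h1
    have B := hasSum_norm_sq_powerSeries hPs h0.le h1
    have B' : HasSum (fun k => 2 * Real.pi * (‖p k‖ ^ 2 * ρ ^ (2 * k)))
        (∑ k ∈ Finset.range n, 2 * Real.pi * (‖p k‖ ^ 2 * ρ ^ (2 * k))) :=
      hasSum_sum_of_ne_finset_zero fun k hk => by
        rw [hp k (by simpa using hk)]; simp
    have I := setIntegral_mono_on (integrableOn_norm_sq_circle (hd.mul hPc.continuousOn) h0.le h1)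
      (integrableOn_norm_sq_circle hPc.continuousOn h0.le h1) measurableSet_Ioo
      (fun θ _ => by
        have := hw _ (circle_mem_ball h0.le h1 θ)
        rw [Pi.mul_apply, norm_mul]
        gcongr
        exact mul_le_of_le_one_left (norm_nonneg _) this)
    rw [B.unique B'] at I
    have J := (sum_le_hasSum (Finset.range N) (fun k _ => by positivity) A).trans I
    rw [← Finset.mul_sum, ← Finset.mul_sum] at J
    refine (le_of_mul_le_mul_left J (by positivity)).trans (Finset.sum_le_sum fun k _ => ?_)
    exact mul_le_of_le_one_right (by positivity) (pow_le_one₀ h0.le h1.le)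
  have hlim : Filter.Tendsto (fun ρ : ℝ => ∑ k ∈ Finset.range N, ‖q k‖ ^ 2 * ρ ^ (2 * k))
      (nhdsWithin 1 (Set.Iio 1)) (nhds (∑ k ∈ Finset.range N, ‖q k‖ ^ 2)) := by
    have : Continuous fun ρ : ℝ => ∑ k ∈ Finset.range N, ‖q k‖ ^ 2 * ρ ^ (2 * k) := by fun_prop
    simpa using (this.tendsto 1).mono_left nhdsWithin_le_nhds
  exact le_of_tendsto hlim (Filter.mem_of_superset (Ioo_mem_nhdsLT one_pos) hR)

end PowerSeries

/-! ### Rogosinski's inequality for the partial sums -/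

/-- The inequality behind the fact that `w ↦ (w - b) / (1 - conj b * w)` maps the closed unit
disc to itself. -/
theorem norm_sub_le_norm_one_sub_conj_mul {b w : ℂ} (hb : ‖b‖ ≤ 1) (hw : ‖w‖ ≤ 1) :
    ‖w - b‖ ≤ ‖1 - (starRingEnd ℂ) b * w‖ := by
  rw [← sq_le_sq₀ (norm_nonneg _) (norm_nonneg _)]
  have e : ‖1 - (starRingEnd ℂ) b * w‖ ^ 2 - ‖w - b‖ ^ 2 = (1 - ‖b‖ ^ 2) * (1 - ‖w‖ ^ 2) := by
    simp only [← Complex.normSq_eq_norm_sq, Complex.normSq_apply]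
    simp
    ring
  have h1 : 0 ≤ 1 - ‖b‖ ^ 2 := by nlinarith [norm_nonneg b]
  have h2 : 0 ≤ 1 - ‖w‖ ^ 2 := by nlinarith [norm_nonneg w]
  nlinarith [mul_nonneg h1 h2]

namespace IsBoundedAnalytic

variable {f : ℂ → ℂ} {a : ℕ → ℂ}

theorem differentiableOn (hf : IsBoundedAnalytic f a) :
    DifferentiableOn ℂ f (Metric.ball 0 1) := hf.analytic.differentiableOn

theorem sum_norm_sq_le_one (hf : IsBoundedAnalytic f a) (n : ℕ) :
    ∑ k ∈ Finset.range n, ‖a k‖ ^ 2 ≤ 1 := by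
  have h := sum_norm_sq_mul_polynomial_le hf.hasSum hf.differentiableOn.continuousOn
    hf.norm_le_one (p := fun k => if k = 0 then 1 else 0) (n := 1)
    (fun k hk => if_neg (by omega)) n
  have e : ∀ k, ∑ q ∈ Finset.HasAntidiagonal.antidiagonal k, a q.1 * (if q.2 = 0 then 1 else 0) =
      a k := by
    intro k
    rw [Finset.sum_eq_single (k, 0)]
    · simp
    · rintro ⟨i, j⟩ hij hne
      have := Finset.HasAntidiagonal.mem_antidiagonal.mp hij
      have hj : j ≠ 0 := by
        rintro rfl
        exact hne (by simpa using this)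
      simp [hj]
    · simp
  simp only [e] at h
  simpa using h

theorem norm_coeff_zero_le_one (hf : IsBoundedAnalytic f a) : ‖a 0‖ ≤ 1 := by
  have h := hf.sum_norm_sq_le_one 1
  simp at h
  nlinarith [norm_nonneg (a 0)]

/-- One step of the recursion for `∑_{1 ≤ k ≤ n} ‖a k‖²`: compare coefficients in
`f - a 0 = w * (1 - conj (a 0) * f)`, where `w` is bounded by one and vanishes at `0`, so that
only coefficients of lower order enter on the right. -/
theorem sum_norm_sq_succ_le (hf : IsBoundedAnalytic f a) (hb : ‖a 0‖ < 1) (n : ℕ) :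
    ∑ k ∈ Finset.range (n + 1), ‖a (k + 1)‖ ^ 2 ≤
      (1 - ‖a 0‖ ^ 2) ^ 2 + ‖a 0‖ ^ 2 * ∑ k ∈ Finset.range n, ‖a (k + 1)‖ ^ 2 := by
  set b := a 0 with hbdef
  set E : ℂ → ℂ := fun z => 1 - (starRingEnd ℂ) b * f z with hE
  set e : ℕ → ℂ := fun k => (if k = 0 then 1 else 0) - (starRingEnd ℂ) b * a k with he
  set d : ℕ → ℂ := fun k => a k - (if k = 0 then b else 0) with hd
  have hconst : ∀ (x z : ℂ), HasSum (fun k : ℕ => (if k = 0 then x else 0) * z ^ k) x := by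
    intro x z
    convert! hasSum_single (f := fun k : ℕ => (if k = 0 then x else 0) * z ^ k) 0 ?_ using 1
    · simp
    · intro k hk
      simp [hk]
  have hEs : ∀ z ∈ Metric.ball (0 : ℂ) 1, HasSum (fun k : ℕ => e k * z ^ k) (E z) := by
    intro z hz
    convert! (hconst 1 z).sub ((hf.hasSum z hz).mul_left ((starRingEnd ℂ) b)) using 1
    ext k
    simp only [he]
    ring
  have hDs : ∀ z ∈ Metric.ball (0 : ℂ) 1, HasSum (fun k : ℕ => d k * z ^ k) (f z - b) := by
    intro z hz
    convert! (hf.hasSum z hz).sub (hconst b z) using 1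
    ext k
    simp only [hd]
    ring
  have hE0 : ∀ z ∈ Metric.ball (0 : ℂ) 1, E z ≠ 0 := by
    intro z hz h0
    have h1 : ‖(starRingEnd ℂ) b * f z‖ = 1 := by rw [← sub_eq_zero.mp h0]; simp
    rw [norm_mul, RCLike.norm_conj] at h1
    nlinarith [norm_nonneg b, norm_nonneg (f z), hf.norm_le_one z hz]
  set w : ℂ → ℂ := fun z => (f z - b) / E z with hw
  have hwd : DifferentiableOn ℂ w (Metric.ball 0 1) :=
    (hf.differentiableOn.sub_const b).div
      ((hf.differentiableOn.const_mul _).const_sub 1) hE0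
  have hw1 : ∀ z ∈ Metric.ball (0 : ℂ) 1, ‖w z‖ ≤ 1 := by
    intro z hz
    rw [hw, norm_div]
    exact div_le_one_of_le₀ (norm_sub_le_norm_one_sub_conj_mul hb.le (hf.norm_le_one z hz))
      (norm_nonneg _)
  set c : ℕ → ℂ := fun k => (k.factorial : ℂ)⁻¹ * iteratedDeriv k w 0 with hc
  have hws : ∀ z ∈ Metric.ball (0 : ℂ) 1, HasSum (fun k : ℕ => c k * z ^ k) (w z) := by
    intro z hz
    convert! Complex.hasSum_taylorSeries_on_ball hwd hz using 1
    ext k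
    simp only [hc, smul_eq_mul, sub_zero]
    ring
  have hd0 : d 0 = 0 := by simp [hd, hbdef]
  have hmul : (fun k => ∑ p ∈ Finset.HasAntidiagonal.antidiagonal k, c p.1 * e p.2) = d := by
    refine coeff_unique (h := fun z => f z - b) (fun z hz => ?_) hDs
    convert! hasSum_antidiagonal hws hEs z hz using 1
    rw [hw, div_mul_cancel₀ _ (hE0 z hz)]
  have he0 : e 0 = 1 - (‖b‖ : ℂ) ^ 2 := by
    simp only [he, if_true, ← hbdef]
    rw [mul_comm, Complex.mul_conj, Complex.normSq_eq_norm_sq]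
    push_cast
    rfl
  have hb2 : 0 < 1 - ‖b‖ ^ 2 := by nlinarith [norm_nonneg b]
  have he0' : ‖e 0‖ = 1 - ‖b‖ ^ 2 := by
    rw [he0, show (1 - (‖b‖ : ℂ) ^ 2) = ((1 - ‖b‖ ^ 2 : ℝ) : ℂ) by push_cast; rfl,
      Complex.norm_real, Real.norm_of_nonneg hb2.le]
  have hc0 : c 0 = 0 := by
    have h := congrFun hmul 0
    simp only [Finset.Nat.antidiagonal_zero, Finset.sum_singleton, hd0] at h
    refine (mul_eq_zero.mp h).resolve_right fun h' => ?_
    rw [h', norm_zero] at he0'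
    exact hb2.ne he0'
  have key := sum_norm_sq_mul_polynomial_le hws hwd.continuousOn hw1
    (p := fun k => if k < n + 1 then e k else 0) (n := n + 1)
    (fun k hk => if_neg (by omega)) (n + 2)
  have hq : ∀ k ∈ Finset.range (n + 2),
      ‖∑ q ∈ Finset.HasAntidiagonal.antidiagonal k,
        c q.1 * (if q.2 < n + 1 then e q.2 else 0)‖ ^ 2 = ‖d k‖ ^ 2 := by
    intro k hk
    rw [← congrFun hmul k]
    congr 2
    refine Finset.sum_congr rfl fun p hp => ?_
    have := Finset.HasAntidiagonal.mem_antidiagonal.mp hp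
    have := Finset.mem_range.mp hk
    split_ifs with h
    · rfl
    · rw [show p.1 = 0 by omega, hc0, zero_mul, zero_mul]
  have hp : ∀ k ∈ Finset.range (n + 1), ‖if k < n + 1 then e k else 0‖ ^ 2 = ‖e k‖ ^ 2 :=
    fun k hk => by rw [if_pos (Finset.mem_range.mp hk)]
  rw [Finset.sum_congr rfl hq, Finset.sum_congr rfl hp, Finset.sum_range_succ' _ (n + 1),
    Finset.sum_range_succ' (fun k => ‖e k‖ ^ 2) n, hd0, he0'] at key
  simp only [hd, he, Nat.add_eq_zero_iff, one_ne_zero, and_false, if_false, sub_zero, zero_sub,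
    norm_neg, norm_mul, RCLike.norm_conj, mul_pow, norm_zero] at key
  rw [Finset.mul_sum]
  linarith

/-- Rogosinski's inequality: the partial sums of `‖a k‖²` are dominated by those of the disc
automorphism `(b - z) / (1 - b * z)` with the same `b = ‖a 0‖`. -/
theorem sum_norm_sq_le_sum_automorphism (hf : IsBoundedAnalytic f a) (n : ℕ) :
    ∑ k ∈ Finset.range n, ‖a (k + 1)‖ ^ 2 ≤
      ∑ k ∈ Finset.range n, ((1 - ‖a 0‖ ^ 2) * ‖a 0‖ ^ k) ^ 2 := by
  rcases hf.norm_coeff_zero_le_one.lt_or_eq with hb | hb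
  · induction n with
    | zero => simp
    | succ n ih =>
      refine (hf.sum_norm_sq_succ_le hb n).trans ?_
      rw [Finset.sum_range_succ' _ n]
      have e : ∀ k, ((1 - ‖a 0‖ ^ 2) * ‖a 0‖ ^ (k + 1)) ^ 2 =
          ‖a 0‖ ^ 2 * ((1 - ‖a 0‖ ^ 2) * ‖a 0‖ ^ k) ^ 2 := fun k => by ring
      simp only [e]
      rw [← Finset.mul_sum]
      have := mul_le_mul_of_nonneg_left ih (sq_nonneg ‖a 0‖)
      linarith
  · have h := hf.sum_norm_sq_le_one (n + 1)
    rw [Finset.sum_range_succ', hb] at h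
    rw [hb]
    simp at h ⊢
    exact h

end IsBoundedAnalytic

/-! ### Monotone weights -/

/-- Summation by parts: a domination of partial sums is preserved by nonincreasing nonnegative
weights. -/
theorem sum_mul_le_sum_mul_of_antitone {l x y : ℕ → ℝ} (hl : Antitone l) (h0 : ∀ k, 0 ≤ l k)
    (h : ∀ n, ∑ k ∈ Finset.range n, x k ≤ ∑ k ∈ Finset.range n, y k) (n : ℕ) :
    ∑ k ∈ Finset.range n, l k * x k ≤ ∑ k ∈ Finset.range n, l k * y k := by
  have key : ∀ n, l n * (∑ k ∈ Finset.range (n + 1), (y k - x k)) ≤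
      ∑ k ∈ Finset.range (n + 1), l k * (y k - x k) := by
    intro n
    induction n with
    | zero => simp
    | succ n ih =>
      rw [Finset.sum_range_succ _ (n + 1), Finset.sum_range_succ _ (n + 1), mul_add]
      have h1 : 0 ≤ ∑ k ∈ Finset.range (n + 1), (y k - x k) := by
        rw [Finset.sum_sub_distrib]
        linarith [h (n + 1)]
      linarith [mul_le_mul_of_nonneg_right (hl n.le_succ) h1]
  rcases n with _ | n
  · simp
  · have h1 := key n
    have h2 := mul_nonneg (h0 n) (sub_nonneg.mpr (h (n + 1)))
    rw [← Finset.sum_sub_distrib] at h2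
    have h3 := h2.trans h1
    simp only [mul_sub] at h3
    rw [Finset.sum_sub_distrib] at h3
    linarith

namespace IsBoundedAnalytic

variable {f : ℂ → ℂ} {a : ℕ → ℂ}

/-- Rogosinski's inequality with nonincreasing weights. -/
theorem weighted_sum_norm_sq_le (hf : IsBoundedAnalytic f a) {l : ℕ → ℝ} (hl : Antitone l)
    (h0 : ∀ k, 0 ≤ l k) {A : ℝ}
    (hA : HasSum (fun k => l k * ((1 - ‖a 0‖ ^ 2) * ‖a 0‖ ^ k) ^ 2) A) (n : ℕ) :
    ∑ k ∈ Finset.range n, l k * ‖a (k + 1)‖ ^ 2 ≤ A :=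
  (sum_mul_le_sum_mul_of_antitone hl h0 hf.sum_norm_sq_le_sum_automorphism n).trans
    (sum_le_hasSum _ (fun k _ => mul_nonneg (h0 k) (sq_nonneg _)) hA)

/-- The weights are `k * r ^ (2 * k)`; they decrease because `r ^ 2 ≤ 1 / 2`. -/
theorem sum_area_le (hf : IsBoundedAnalytic f a) {r : ℝ} (h2 : r ^ 2 ≤ 1 / 2) (n : ℕ) :
    ∑ k ∈ Finset.range n, (k + 1) * ‖a (k + 1)‖ ^ 2 * r ^ (2 * k + 2) ≤
      r ^ 2 * (1 - ‖a 0‖ ^ 2) ^ 2 / (1 - ‖a 0‖ ^ 2 * r ^ 2) ^ 2 := by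
  have hb := hf.norm_coeff_zero_le_one
  have hb0 := norm_nonneg (a 0)
  set b := ‖a 0‖
  have hl : Antitone fun k : ℕ => ((k : ℝ) + 1) * (r ^ 2) ^ (k + 1) := by
    refine antitone_nat_of_succ_le fun k => ?_
    push_cast
    rw [pow_succ _ (k + 1)]
    have h3 : 0 ≤ (r ^ 2) ^ (k + 1) := by positivity
    have h4 : ((k : ℝ) + 1 + 1) * r ^ 2 ≤ k + 1 := by
      have := Nat.cast_nonneg (α := ℝ) k
      nlinarith
    nlinarith [mul_le_mul_of_nonneg_left h4 h3]
  have hx : ‖b ^ 2 * r ^ 2‖ < 1 := by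
    rw [Real.norm_of_nonneg (by positivity)]
    nlinarith [sq_nonneg r]
  have hA : HasSum (fun k : ℕ => ((k : ℝ) + 1) * (r ^ 2) ^ (k + 1) * ((1 - b ^ 2) * b ^ k) ^ 2)
      (r ^ 2 * (1 - b ^ 2) ^ 2 / (1 - b ^ 2 * r ^ 2) ^ 2) := by
    have hne : 1 - b ^ 2 * r ^ 2 ≠ 0 := by
      have := (le_abs_self _).trans_lt hx
      linarith
    have g := ((hasSum_coe_mul_geometric_of_norm_lt_one hx).add
      (hasSum_geometric_of_norm_lt_one hx)).mul_left (r ^ 2 * (1 - b ^ 2) ^ 2)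
    convert! g using 1
    · ext k
      ring
    · field_simp
      ring
  refine le_trans (le_of_eq (Finset.sum_congr rfl fun k _ => ?_))
    (hf.weighted_sum_norm_sq_le hl (fun k => by positivity) hA n)
  ring

/-- For `r ≤ ‖a 0‖` the automorphism maximizes the Bohr sum: the weights `(r / ‖a 0‖) ^ k` are then
nonincreasing. -/
theorem sum_norm_mul_pow_le_of_le (hf : IsBoundedAnalytic f a) {r : ℝ} (h0 : 0 < r) (h1 : r < 1)
    (hr : r ≤ ‖a 0‖) (n : ℕ) :
    ∑ k ∈ Finset.range n, ‖a (k + 1)‖ * r ^ (k + 1) ≤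
      r * (1 - ‖a 0‖ ^ 2) / (1 - r * ‖a 0‖) := by
  have hb := hf.norm_coeff_zero_le_one
  set b := ‖a 0‖ with hbdef
  have hb0 : 0 < b := h0.trans_le hr
  rcases hb.lt_or_eq with hb1 | hb1
  swap
  -- if `‖a 0‖ = 1`, all other coefficients vanish
  · have h := hf.sum_norm_sq_le_sum_automorphism n
    rw [← hbdef, hb1] at h
    simp only [one_pow, sub_self, zero_mul, ne_eq, OfNat.ofNat_ne_zero, not_false_eq_true,
      zero_pow, Finset.sum_const_zero] at h
    have h' : ∀ k ∈ Finset.range n, ‖a (k + 1)‖ ^ 2 = 0 := by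
      rw [← Finset.sum_eq_zero_iff_of_nonneg fun k _ => by positivity]
      exact h.antisymm (Finset.sum_nonneg fun k _ => by positivity)
    rw [hb1, Finset.sum_eq_zero fun k hk => by rw [pow_eq_zero_iff two_ne_zero |>.mp (h' k hk),
      zero_mul]]
    simp
  have hs : 0 < 1 - b ^ 2 := by nlinarith
  have hrb : r * b < 1 := by nlinarith
  have hx : ‖r * b‖ < 1 := by rwa [Real.norm_of_nonneg (by positivity)]
  have hne : 1 - r * b ≠ 0 := by linarith
  have hl : Antitone fun k : ℕ => (r / b) ^ (k + 1) := fun i j hij =>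
    pow_le_pow_of_le_one (by positivity) ((div_le_one hb0).mpr hr) (by omega)
  have hA : HasSum (fun k : ℕ => (r / b) ^ (k + 1) * ((1 - b ^ 2) * b ^ k) ^ 2)
      (r / b * (1 - b ^ 2) ^ 2 / (1 - r * b)) := by
    convert! (hasSum_geometric_of_norm_lt_one hx).mul_left (r / b * (1 - b ^ 2) ^ 2) using 1
    ext k
    rw [div_pow, mul_pow r b]
    field_simp
    ring
  have hG : ∑ k ∈ Finset.range n, (r * b) ^ (k + 1) ≤ r * b / (1 - r * b) := by
    have h : HasSum (fun k : ℕ => (r * b) ^ (k + 1)) (r * b / (1 - r * b)) := by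
      convert! (hasSum_geometric_of_norm_lt_one hx).mul_left (r * b) using 1
      ext k
      ring
    exact sum_le_hasSum (Finset.range n) (fun k _ => by positivity) h
  have hW := hf.weighted_sum_norm_sq_le hl (fun k => by positivity) hA n
  calc ∑ k ∈ Finset.range n, ‖a (k + 1)‖ * r ^ (k + 1)
      ≤ ∑ k ∈ Finset.range n, (b / (1 - b ^ 2) / 2 * ((r / b) ^ (k + 1) * ‖a (k + 1)‖ ^ 2) +
          (1 - b ^ 2) / b / 2 * (r * b) ^ (k + 1)) := by
        refine Finset.sum_le_sum fun k _ => ?_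
        -- the arithmetic–geometric mean inequality, with equality for the automorphism
        have hsq : b / (1 - b ^ 2) / 2 * ((r / b) ^ (k + 1) * ‖a (k + 1)‖ ^ 2) +
            (1 - b ^ 2) / b / 2 * (r * b) ^ (k + 1) - ‖a (k + 1)‖ * r ^ (k + 1) =
            r ^ (k + 1) / (2 * (1 - b ^ 2) * b ^ k) *
              (‖a (k + 1)‖ - (1 - b ^ 2) * b ^ k) ^ 2 := by
          rw [div_pow, mul_pow, pow_succ b]
          field_simp
          ring
        have : 0 ≤ r ^ (k + 1) / (2 * (1 - b ^ 2) * b ^ k) *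
              (‖a (k + 1)‖ - (1 - b ^ 2) * b ^ k) ^ 2 := by positivity
        linarith
    _ ≤ b / (1 - b ^ 2) / 2 * (r / b * (1 - b ^ 2) ^ 2 / (1 - r * b)) +
          (1 - b ^ 2) / b / 2 * (r * b / (1 - r * b)) := by
        rw [Finset.sum_add_distrib, ← Finset.mul_sum, ← Finset.mul_sum]
        gcongr
    _ = r * (1 - b ^ 2) / (1 - r * b) := by
        field_simp
        ring

/-- A bound on the Bohr sum for every value of `‖a 0‖`, used when `‖a 0‖ < r`. The parameter `t > 0`
is free; it weights the arithmetic–geometric mean inequality. -/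
theorem sum_norm_mul_pow_le (hf : IsBoundedAnalytic f a) {r : ℝ} (h0 : 0 ≤ r) (h1 : r < 1)
    {t : ℝ} (ht : 0 < t) (n : ℕ) :
    ∑ k ∈ Finset.range n, ‖a (k + 1)‖ * r ^ (k + 1) ≤
      (t * (1 - ‖a 0‖ ^ 2) + r ^ 2 / (1 - r ^ 2) / t) / 2 := by
  have hS : ∑ k ∈ Finset.range n, ‖a (k + 1)‖ ^ 2 ≤ 1 - ‖a 0‖ ^ 2 := by
    have := hf.sum_norm_sq_le_one (n + 1)
    rw [Finset.sum_range_succ'] at this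
    linarith
  have hr2 : r ^ 2 < 1 := by nlinarith
  have hG : ∑ k ∈ Finset.range n, (r ^ 2) ^ (k + 1) ≤ r ^ 2 / (1 - r ^ 2) := by
    have h : HasSum (fun k : ℕ => (r ^ 2) ^ (k + 1)) (r ^ 2 / (1 - r ^ 2)) := by
      convert! (hasSum_geometric_of_lt_one (sq_nonneg r) hr2).mul_left (r ^ 2) using 1
      ext k
      ring
    exact sum_le_hasSum (Finset.range n) (fun k _ => by positivity) h
  calc ∑ k ∈ Finset.range n, ‖a (k + 1)‖ * r ^ (k + 1)
      ≤ ∑ k ∈ Finset.range n, (t * ‖a (k + 1)‖ ^ 2 + (r ^ 2) ^ (k + 1) / t) / 2 := by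
        refine Finset.sum_le_sum fun k _ => ?_
        have hsq : (t * ‖a (k + 1)‖ ^ 2 + (r ^ 2) ^ (k + 1) / t) / 2 - ‖a (k + 1)‖ * r ^ (k + 1) =
            (t * ‖a (k + 1)‖ - r ^ (k + 1)) ^ 2 / t / 2 := by
          rw [← pow_mul, mul_comm 2, pow_mul]
          field_simp
          ring
        have : 0 ≤ (t * ‖a (k + 1)‖ - r ^ (k + 1)) ^ 2 / t / 2 := by positivity
        linarith
    _ ≤ _ := by
        rw [← Finset.sum_div, Finset.sum_add_distrib, ← Finset.mul_sum, ← Finset.sum_div]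
        gcongr

end IsBoundedAnalytic

/-! ### Area of the image of a disc -/

/-- The real Jacobian determinant of a complex-differentiable map is `‖f'‖²`. -/
theorem abs_det_restrictScalars_toSpanSingleton (c : ℂ) :
    |((ContinuousLinearMap.toSpanSingleton ℂ c).restrictScalars ℝ).det| = ‖c‖ ^ 2 := by
  have : ((ContinuousLinearMap.toSpanSingleton ℂ c).restrictScalars ℝ).det = ‖c‖ ^ 2 := by
    simp [ContinuousLinearMap.det, LinearMap.det_restrictScalars, Algebra.norm_complex_eq,
      Complex.normSq_eq_norm_sq]
  rw [this, abs_of_nonneg (by positivity)]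

theorem multiplicityArea_eq_lintegral_det (f : ℂ → ℂ) (r : ℝ) :
    multiplicityArea f r = ∫⁻ z in Metric.ball (0 : ℂ) r, ENNReal.ofReal
      |((ContinuousLinearMap.toSpanSingleton ℂ (deriv f z)).restrictScalars ℝ).det| := by
  simp only [multiplicityArea, abs_det_restrictScalars_toSpanSingleton,
    ENNReal.ofReal_pow (norm_nonneg _), ofReal_norm]

theorem hasFDerivWithinAt_real_of_differentiableOn {f : ℂ → ℂ}
    (hf : DifferentiableOn ℂ f (Metric.ball 0 1)) {r : ℝ} (h1 : r ≤ 1) :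
    ∀ z ∈ Metric.ball (0 : ℂ) r, HasFDerivWithinAt f
      ((ContinuousLinearMap.toSpanSingleton ℂ (deriv f z)).restrictScalars ℝ)
      (Metric.ball 0 r) z := fun _ hz =>
  ((hf.differentiableAt (Metric.isOpen_ball.mem_nhds
    (Metric.ball_subset_ball h1 hz))).hasDerivAt.hasFDerivAt.restrictScalars ℝ).hasFDerivWithinAt

theorem imageArea_le_multiplicityArea {f : ℂ → ℂ}
    (hf : DifferentiableOn ℂ f (Metric.ball 0 1)) {r : ℝ} (h1 : r ≤ 1) :
    imageArea f r ≤ multiplicityArea f r := by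
  rw [multiplicityArea_eq_lintegral_det]
  exact addHaar_image_le_lintegral_abs_det_fderiv volume measurableSet_ball
    (hasFDerivWithinAt_real_of_differentiableOn hf h1)

theorem imageArea_eq_multiplicityArea {f : ℂ → ℂ}
    (hf : DifferentiableOn ℂ f (Metric.ball 0 1)) {r : ℝ} (h1 : r ≤ 1)
    (hinj : Set.InjOn f (Metric.ball 0 r)) :
    imageArea f r = multiplicityArea f r := by
  rw [multiplicityArea_eq_lintegral_det]
  exact (lintegral_abs_det_fderiv_eq_addHaar_image volume measurableSet_ball
    (hasFDerivWithinAt_real_of_differentiableOn hf h1) hinj).symm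

theorem lintegral_ball_eq_polar {g : ℂ → ℂ} (hg : ContinuousOn g (Metric.ball 0 1)) {r : ℝ}
    (h1 : r ≤ 1) :
    ∫⁻ z in Metric.ball (0 : ℂ) r, ‖g z‖ₑ ^ 2 =
      ∫⁻ ρ in Set.Ioo 0 r, ∫⁻ θ in Set.Ioo (-Real.pi) Real.pi,
        ENNReal.ofReal ρ * ‖g (ρ * Complex.exp (θ * Complex.I))‖ₑ ^ 2 := by
  set G : ℝ × ℝ → ℝ≥0∞ := fun p =>
    ENNReal.ofReal p.1 * ‖g (p.1 * Complex.exp (p.2 * Complex.I))‖ₑ ^ 2 with hG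
  have hm : MeasurableSet (Set.Ioo 0 r ×ˢ Set.Ioo (-Real.pi) Real.pi) :=
    measurableSet_Ioo.prod measurableSet_Ioo
  have hcont : AEMeasurable G
      ((volume : Measure (ℝ × ℝ)).restrict (Set.Ioo 0 r ×ˢ Set.Ioo (-Real.pi) Real.pi)) := by
    have h2 : ContinuousOn (fun p : ℝ × ℝ => g (p.1 * Complex.exp (p.2 * Complex.I)))
        (Set.Ioo 0 r ×ˢ Set.Ioo (-Real.pi) Real.pi) :=
      hg.comp (by fun_prop) fun p hp =>
        circle_mem_ball hp.1.1.le (hp.1.2.trans_le h1) p.2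
    exact (ENNReal.measurable_ofReal.comp measurable_fst).aemeasurable.mul
      ((h2.aemeasurable hm).enorm.pow_const 2)
  rw [← lintegral_indicator measurableSet_ball, ← Complex.lintegral_comp_polarCoord_symm]
  have e : ∀ p ∈ polarCoord.target,
      ENNReal.ofReal p.1 • (Metric.ball (0 : ℂ) r).indicator (fun z => ‖g z‖ₑ ^ 2)
        (Complex.polarCoord.symm p) =
      (Set.Iio r ×ˢ Set.univ).indicator G p := by
    rintro ⟨ρ, θ⟩ hp
    have hρ : 0 < ρ := hp.1
    have hz : Complex.polarCoord.symm (ρ, θ) = ρ * Complex.exp (θ * Complex.I) := by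
      rw [Complex.polarCoord_symm_apply, Complex.exp_mul_I]
      push_cast
      rfl
    have hn : ‖(ρ : ℂ) * Complex.exp (θ * Complex.I)‖ = ρ := by
      simp [Complex.norm_exp_ofReal_mul_I, abs_of_pos hρ]
    rw [hz]
    by_cases h : ρ < r
    · rw [Set.indicator_of_mem (by rwa [mem_ball_zero_iff, hn]), Set.indicator_of_mem (by simpa using h),
        smul_eq_mul]
    · rw [Set.indicator_of_notMem (by rwa [mem_ball_zero_iff, hn]),
        Set.indicator_of_notMem (by simpa using h), smul_zero]
  rw [setLIntegral_congr_fun polarCoord.open_target.measurableSet e,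
    setLIntegral_indicator (measurableSet_Iio.prod MeasurableSet.univ)]
  have hset : (Set.Iio r ×ˢ Set.univ) ∩ polarCoord.target =
      Set.Ioo 0 r ×ˢ Set.Ioo (-Real.pi) Real.pi := by
    rw [polarCoord_target, Set.prod_inter_prod, Set.univ_inter, Set.inter_comm, Set.Ioi_inter_Iio]
  rw [hset, Measure.volume_eq_prod, setLIntegral_prod _ hcont]

/-- The mean square over a disc, in terms of the coefficients. -/
theorem lintegral_ball_enorm_sq {g : ℂ → ℂ} {c : ℕ → ℂ}
    (hg : ContinuousOn g (Metric.ball 0 1))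
    (hc : ∀ z ∈ Metric.ball (0 : ℂ) 1, HasSum (fun k : ℕ => c k * z ^ k) (g z))
    {r : ℝ} (h0 : 0 ≤ r) (h1 : r ≤ 1) :
    ∫⁻ z in Metric.ball (0 : ℂ) r, ‖g z‖ₑ ^ 2 =
      ∑' k : ℕ, ENNReal.ofReal (Real.pi * (‖c k‖ ^ 2 * r ^ (2 * k + 2) / (k + 1))) := by
  rw [lintegral_ball_eq_polar hg h1]
  have inner : ∀ ρ ∈ Set.Ioo 0 r, ∫⁻ θ in Set.Ioo (-Real.pi) Real.pi,
        ENNReal.ofReal ρ * ‖g (ρ * Complex.exp (θ * Complex.I))‖ₑ ^ 2 =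
      ∑' k : ℕ, ENNReal.ofReal (2 * Real.pi * ‖c k‖ ^ 2 * ρ ^ (2 * k + 1)) := by
    rintro ρ ⟨hρ, hρr⟩
    have hρ1 := hρr.trans_le h1
    have hP := hasSum_norm_sq_powerSeries hc hρ.le hρ1
    rw [lintegral_const_mul' _ _ ENNReal.ofReal_ne_top]
    have e : ∀ θ : ℝ, ‖g (ρ * Complex.exp (θ * Complex.I))‖ₑ ^ 2 =
        ENNReal.ofReal (‖g (ρ * Complex.exp (θ * Complex.I))‖ ^ 2) := fun θ => by
      rw [ENNReal.ofReal_pow (norm_nonneg _), ofReal_norm]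
    simp only [e]
    rw [← ofReal_integral_eq_lintegral_ofReal (integrableOn_norm_sq_circle hg hρ.le hρ1)
      (Filter.Eventually.of_forall fun θ => by positivity), ← hP.tsum_eq,
      ENNReal.ofReal_tsum_of_nonneg (fun k => by positivity) hP.summable, ← ENNReal.tsum_mul_left]
    refine tsum_congr fun k => ?_
    rw [← ENNReal.ofReal_mul hρ.le]
    congr 1
    ring
  rw [setLIntegral_congr_fun measurableSet_Ioo inner,
    lintegral_tsum fun k => by fun_prop]
  refine tsum_congr fun k => ?_
  have hint : IntegrableOn (fun ρ : ℝ => 2 * Real.pi * ‖c k‖ ^ 2 * ρ ^ (2 * k + 1))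
      (Set.Ioo 0 r) :=
    ((by fun_prop : Continuous fun ρ : ℝ => 2 * Real.pi * ‖c k‖ ^ 2 * ρ ^ (2 * k + 1)).continuousOn
      |>.integrableOn_Icc).mono_set Set.Ioo_subset_Icc_self
  rw [← ofReal_integral_eq_lintegral_ofReal hint ((ae_restrict_iff' measurableSet_Ioo).mpr
    (Filter.Eventually.of_forall fun ρ hρ => by have := hρ.1; positivity)),
    ← integral_Ioc_eq_integral_Ioo, ← intervalIntegral.integral_of_le h0,
    intervalIntegral.integral_const_mul, integral_pow]
  congr 1
  push_cast
  field_simp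
  ring

namespace IsBoundedAnalytic

variable {f : ℂ → ℂ} {a : ℕ → ℂ}

theorem hasSum_deriv (hf : IsBoundedAnalytic f a) :
    ∀ z ∈ Metric.ball (0 : ℂ) 1,
      HasSum (fun k : ℕ => ((k : ℂ) + 1) * a (k + 1) * z ^ k) (deriv f z) := by
  have ha : (fun k : ℕ => (k.factorial : ℂ)⁻¹ * iteratedDeriv k f 0) = a := by
    refine coeff_unique (fun z hz => ?_) hf.hasSum
    convert! Complex.hasSum_taylorSeries_on_ball hf.differentiableOn hz using 1
    ext k
    simp only [smul_eq_mul, sub_zero]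
    ring
  intro z hz
  convert! Complex.hasSum_taylorSeries_on_ball
    (hf.differentiableOn.deriv Metric.isOpen_ball) hz using 1
  ext k
  rw [← ha]
  have : (k.factorial : ℂ) ≠ 0 := Nat.cast_ne_zero.mpr k.factorial_ne_zero
  have h' : (k : ℂ) + 1 ≠ 0 := Nat.cast_add_one_ne_zero k
  simp only [smul_eq_mul, sub_zero, iteratedDeriv_succ', Nat.factorial_succ]
  push_cast
  field_simp

theorem multiplicityArea_eq_tsum (hf : IsBoundedAnalytic f a) {r : ℝ} (h0 : 0 ≤ r) (h1 : r ≤ 1) :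
    multiplicityArea f r = ∑' k : ℕ,
      ENNReal.ofReal (Real.pi * ((k + 1) * ‖a (k + 1)‖ ^ 2 * r ^ (2 * k + 2))) := by
  rw [multiplicityArea, lintegral_ball_enorm_sq
    (hf.differentiableOn.deriv Metric.isOpen_ball).continuousOn hf.hasSum_deriv h0 h1]
  refine tsum_congr fun k => ?_
  congr 2
  rw [norm_mul, show ((k : ℂ) + 1) = ((k + 1 : ℕ) : ℂ) by push_cast; rfl, Complex.norm_natCast]
  push_cast
  field_simp

/-- Sharp bound on the area in terms of `‖f 0‖`. -/
theorem multiplicityArea_le (hf : IsBoundedAnalytic f a) {r : ℝ} (h0 : 0 ≤ r)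
    (h2 : r ^ 2 ≤ 1 / 2) :
    multiplicityArea f r ≤ ENNReal.ofReal
      (Real.pi * (r ^ 2 * (1 - ‖a 0‖ ^ 2) ^ 2 / (1 - ‖a 0‖ ^ 2 * r ^ 2) ^ 2)) := by
  rw [hf.multiplicityArea_eq_tsum h0 (by nlinarith)]
  refine ENNReal.tsum_le_of_sum_range_le fun n => ?_
  rw [← ENNReal.ofReal_sum_of_nonneg fun k _ => by positivity, ← Finset.mul_sum]
  exact ENNReal.ofReal_le_ofReal
    (mul_le_mul_of_nonneg_left (hf.sum_area_le h2 n) Real.pi_pos.le)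

end IsBoundedAnalytic

theorem multiplicityArea_mono (f : ℂ → ℂ) {r R : ℝ} (h : r ≤ R) :
    multiplicityArea f r ≤ multiplicityArea f R :=
  lintegral_mono_set (Metric.ball_subset_ball h)

/-! ### The two inequalities -/

/-- The first inequality at `r = 1 / 3`, with the area replaced by its sharp upper bound and the sum
by a common bound `B` of its partial sums. -/
theorem norm_add_sum_add_area_le_one {f : ℂ → ℂ} {a : ℕ → ℂ} (hf : IsBoundedAnalytic f a) :
    ∃ B : ℝ, (∀ n, ∑ k ∈ Finset.range n, ‖a (k + 1)‖ * (1 / 3 : ℝ) ^ (k + 1) ≤ B) ∧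
      ‖a 0‖ + B + 16 / 9 * ((1 / 3) ^ 2 * (1 - ‖a 0‖ ^ 2) ^ 2 /
        (1 - ‖a 0‖ ^ 2 * (1 / 3) ^ 2) ^ 2) ≤ 1 := by
  have hb0 := norm_nonneg (a 0)
  have hb1 := hf.norm_coeff_zero_le_one
  have e : (1 / 3 : ℝ) ^ 2 * (1 - ‖a 0‖ ^ 2) ^ 2 / (1 - ‖a 0‖ ^ 2 * (1 / 3) ^ 2) ^ 2 =
      9 * ((1 - ‖a 0‖ ^ 2) / (9 - ‖a 0‖ ^ 2)) ^ 2 := by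
    have h1 : 9 - ‖a 0‖ ^ 2 ≠ 0 := by nlinarith
    rw [show 1 - ‖a 0‖ ^ 2 * (1 / 3) ^ 2 = (9 - ‖a 0‖ ^ 2) / 9 by ring]
    field_simp
    ring
  rw [e]
  rcases le_or_gt (1 / 3) ‖a 0‖ with h | h
  · refine ⟨_, hf.sum_norm_mul_pow_le_of_le (by norm_num) (by norm_num) h, ?_⟩
    set b := ‖a 0‖
    have h1 : 0 < 9 - b ^ 2 := by nlinarith
    have h2 : 0 < 3 - b := by linarith
    have h3 : 0 < 3 + b := by linarith
    have e1 : b + 1 / 3 * (1 - b ^ 2) / (1 - 1 / 3 * b) +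
        16 / 9 * (9 * ((1 - b ^ 2) / (9 - b ^ 2)) ^ 2) =
        1 - 2 * (1 - b) ^ 3 * (b ^ 2 + 12 * b + 19) / ((3 - b) ^ 2 * (3 + b) ^ 2) := by
      rw [show 9 - b ^ 2 = (3 - b) * (3 + b) by ring,
        show 1 - 1 / 3 * b = (3 - b) / 3 by ring]
      field_simp
      ring
    rw [e1]
    have h4 : 0 ≤ 1 - b := by linarith
    have : 0 ≤ 2 * (1 - b) ^ 3 * (b ^ 2 + 12 * b + 19) / ((3 - b) ^ 2 * (3 + b) ^ 2) := by
      positivity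
    linarith
  · refine ⟨_, hf.sum_norm_mul_pow_le (by norm_num) (by norm_num) (t := 1 / 3) (by norm_num), ?_⟩
    set b := ‖a 0‖
    have h1 : (1 - b ^ 2) / (9 - b ^ 2) ≤ 1 / 9 := by
      rw [div_le_iff₀ (by nlinarith)]
      nlinarith
    have h2 : 0 ≤ (1 - b ^ 2) / (9 - b ^ 2) := div_nonneg (by nlinarith) (by nlinarith)
    have h3 : ((1 - b ^ 2) / (9 - b ^ 2)) ^ 2 ≤ (1 / 9) ^ 2 := by gcongr
    norm_num at h3 ⊢
    nlinarith

/-- The second inequality at `r = 1 / 2`, in the same form. -/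
theorem norm_sq_add_sum_add_area_le_one {f : ℂ → ℂ} {a : ℕ → ℂ} (hf : IsBoundedAnalytic f a) :
    ∃ B : ℝ, (∀ n, ∑ k ∈ Finset.range n, ‖a (k + 1)‖ * (1 / 2 : ℝ) ^ (k + 1) ≤ B) ∧
      ‖a 0‖ ^ 2 + B + 9 / 8 * ((1 / 2) ^ 2 * (1 - ‖a 0‖ ^ 2) ^ 2 /
        (1 - ‖a 0‖ ^ 2 * (1 / 2) ^ 2) ^ 2) ≤ 1 := by
  have hb0 := norm_nonneg (a 0)
  have hb1 := hf.norm_coeff_zero_le_one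
  have e : (1 / 2 : ℝ) ^ 2 * (1 - ‖a 0‖ ^ 2) ^ 2 / (1 - ‖a 0‖ ^ 2 * (1 / 2) ^ 2) ^ 2 =
      4 * ((1 - ‖a 0‖ ^ 2) / (4 - ‖a 0‖ ^ 2)) ^ 2 := by
    have h1 : 4 - ‖a 0‖ ^ 2 ≠ 0 := by nlinarith
    rw [show 1 - ‖a 0‖ ^ 2 * (1 / 2) ^ 2 = (4 - ‖a 0‖ ^ 2) / 4 by ring]
    field_simp
    ring
  rw [e]
  rcases le_or_gt (1 / 2) ‖a 0‖ with h | h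
  · refine ⟨_, hf.sum_norm_mul_pow_le_of_le (by norm_num) (by norm_num) h, ?_⟩
    set b := ‖a 0‖
    have h1 : 0 < 4 - b ^ 2 := by nlinarith
    have h2 : 0 < 2 - b := by linarith
    have h3 : 0 < 2 + b := by linarith
    have e1 : b ^ 2 + 1 / 2 * (1 - b ^ 2) / (1 - 1 / 2 * b) +
        9 / 8 * (4 * ((1 - b ^ 2) / (4 - b ^ 2)) ^ 2) =
        1 - (1 - b ^ 2) * (1 - b) ^ 2 * (7 / 2 + 3 * b + b ^ 2) /
          ((2 - b) ^ 2 * (2 + b) ^ 2) := by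
      rw [show 4 - b ^ 2 = (2 - b) * (2 + b) by ring,
        show 1 - 1 / 2 * b = (2 - b) / 2 by ring]
      field_simp
      ring
    rw [e1]
    have h4 : 0 ≤ 1 - b ^ 2 := by nlinarith
    have : 0 ≤ (1 - b ^ 2) * (1 - b) ^ 2 * (7 / 2 + 3 * b + b ^ 2) /
        ((2 - b) ^ 2 * (2 + b) ^ 2) := by
      positivity
    linarith
  · refine ⟨_, hf.sum_norm_mul_pow_le (by norm_num) (by norm_num) (t := 2 / 3) (by norm_num), ?_⟩
    set b := ‖a 0‖
    have h2 : 0 ≤ (1 - b ^ 2) / (4 - b ^ 2) := div_nonneg (by nlinarith) (by nlinarith)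
    have h1 : (1 - b ^ 2) / (4 - b ^ 2) ≤ 1 / 4 := by
      rw [div_le_iff₀ (by nlinarith)]
      nlinarith
    -- the denominator is at least `15 / 4` because `b < 1 / 2`
    have h3 : (1 - b ^ 2) / (4 - b ^ 2) ≤ (1 - b ^ 2) * (4 / 15) := by
      rw [div_le_iff₀ (by nlinarith)]
      have h4 : 0 ≤ 1 - b ^ 2 := by nlinarith
      have h5 : 0 ≤ 1 / 4 - b ^ 2 := by nlinarith
      nlinarith [mul_nonneg h4 h5]
    have h4 : ((1 - b ^ 2) / (4 - b ^ 2)) ^ 2 ≤ 1 / 4 * ((1 - b ^ 2) * (4 / 15)) := by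
      rw [sq]
      gcongr
    norm_num at h4 ⊢
    nlinarith

/-! ### Disc automorphisms -/

/-- The disc automorphism `z ↦ (b - z) / (1 - b * z)` with real parameter `b`. -/
noncomputable def discAutomorphism (b : ℝ) (z : ℂ) : ℂ := (b - z) / (1 - b * z)

/-- The Taylor coefficients of `discAutomorphism b`. -/
noncomputable def discAutomorphismCoeff (b : ℝ) : ℕ → ℂ
  | 0 => b
  | k + 1 => -((1 - b ^ 2) * b ^ k : ℝ)

section DiscAutomorphism

variable {b : ℝ}

theorem one_sub_ofReal_mul_ne_zero (h0 : 0 < b) (h1 : b < 1) {z : ℂ}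
    (hz : z ∈ Metric.ball (0 : ℂ) 1) : 1 - (b : ℂ) * z ≠ 0 := by
  intro h
  have h2 : ‖(b : ℂ) * z‖ = 1 := by rw [← sub_eq_zero.mp h]; simp
  rw [norm_mul, Complex.norm_real, Real.norm_of_nonneg h0.le] at h2
  have := mem_ball_zero_iff.mp hz
  nlinarith [norm_nonneg z]

theorem isBoundedAnalytic_discAutomorphism (h0 : 0 < b) (h1 : b < 1) :
    IsBoundedAnalytic (discAutomorphism b) (discAutomorphismCoeff b) where
  analytic := by
    refine DifferentiableOn.analyticOnNhd (fun z hz => ?_) Metric.isOpen_ball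
    have := one_sub_ofReal_mul_ne_zero h0 h1 hz
    unfold discAutomorphism
    fun_prop (disch := assumption)
  hasSum z hz := by
    have hne := one_sub_ofReal_mul_ne_zero h0 h1 hz
    have hn : ‖(b : ℂ) * z‖ < 1 := by
      rw [norm_mul, Complex.norm_real, Real.norm_of_nonneg h0.le]
      have := mem_ball_zero_iff.mp hz
      nlinarith [norm_nonneg z]
    rw [← hasSum_nat_add_iff' 1]
    convert! (hasSum_geometric_of_norm_lt_one hn).mul_left (-((1 - (b : ℂ) ^ 2) * z)) using 1
    · ext k
      simp only [discAutomorphismCoeff]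
      push_cast
      ring
    · simp only [discAutomorphism, discAutomorphismCoeff, Finset.sum_range_one, pow_zero, mul_one]
      field_simp
      ring
  norm_le_one z hz := by
    have h := norm_sub_le_norm_one_sub_conj_mul (b := (b : ℂ)) (w := z)
      (by rw [Complex.norm_real, Real.norm_of_nonneg h0.le]; exact h1.le)
      (mem_ball_zero_iff.mp hz).le
    rw [Complex.conj_ofReal] at h
    rw [discAutomorphism, norm_div, norm_sub_rev]
    exact div_le_one_of_le₀ h (norm_nonneg _)

theorem injOn_discAutomorphism (h0 : 0 < b) (h1 : b < 1) :
    Set.InjOn (discAutomorphism b) (Metric.ball 0 1) := by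
  intro z hz w hw h
  rw [discAutomorphism, discAutomorphism, div_eq_div_iff (one_sub_ofReal_mul_ne_zero h0 h1 hz)
    (one_sub_ofReal_mul_ne_zero h0 h1 hw)] at h
  have h2 : (1 - (b : ℂ) ^ 2) * (w - z) = 0 := by linear_combination h
  have h3 : 1 - (b : ℂ) ^ 2 ≠ 0 := by
    have : (1 - b ^ 2 : ℝ) ≠ 0 := by nlinarith
    exact_mod_cast this
  exact (sub_eq_zero.mp ((mul_eq_zero.mp h2).resolve_left h3)).symm

theorem norm_discAutomorphismCoeff_zero (h0 : 0 < b) : ‖discAutomorphismCoeff b 0‖ = b := by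
  rw [discAutomorphismCoeff, Complex.norm_real, Real.norm_of_nonneg h0.le]

theorem norm_discAutomorphismCoeff_succ (h0 : 0 < b) (h1 : b < 1) (k : ℕ) :
    ‖discAutomorphismCoeff b (k + 1)‖ = (1 - b ^ 2) * b ^ k := by
  have : 0 ≤ 1 - b ^ 2 := by nlinarith
  rw [discAutomorphismCoeff, norm_neg, Complex.norm_real, Real.norm_of_nonneg (by positivity)]

theorem hasSum_discAutomorphismCoeff_succ (h0 : 0 < b) (h1 : b < 1) {r : ℝ} (hr0 : 0 ≤ r)
    (hr1 : r < 1) : HasSum (fun k : ℕ => ‖discAutomorphismCoeff b (k + 1)‖ * r ^ (k + 1))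
      (r * (1 - b ^ 2) / (1 - r * b)) := by
  convert! (hasSum_geometric_of_lt_one (mul_nonneg hr0 h0.le)
    (by nlinarith : r * b < 1)).mul_left (r * (1 - b ^ 2)) using 1
  ext k
  rw [norm_discAutomorphismCoeff_succ h0 h1]
  ring

theorem tsum_discAutomorphismCoeff (h0 : 0 < b) (h1 : b < 1) {r : ℝ} (hr0 : 0 ≤ r)
    (hr1 : r < 1) : ∑' k : ℕ, ‖discAutomorphismCoeff b k‖ * r ^ k =
      b + r * (1 - b ^ 2) / (1 - r * b) := by
  refine HasSum.tsum_eq ?_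
  rw [← hasSum_nat_add_iff' 1]
  convert! hasSum_discAutomorphismCoeff_succ h0 h1 hr0 hr1 using 1
  simp [norm_discAutomorphismCoeff_zero h0]

theorem multiplicityArea_discAutomorphism (h0 : 0 < b) (h1 : b < 1) {r : ℝ} (hr0 : 0 ≤ r)
    (hr1 : r < 1) : multiplicityArea (discAutomorphism b) r = ENNReal.ofReal
      (Real.pi * (r ^ 2 * (1 - b ^ 2) ^ 2 / (1 - b ^ 2 * r ^ 2) ^ 2)) := by
  rw [(isBoundedAnalytic_discAutomorphism h0 h1).multiplicityArea_eq_tsum hr0 hr1.le]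
  have hx : ‖b ^ 2 * r ^ 2‖ < 1 := by
    rw [Real.norm_of_nonneg (by positivity)]
    have hb2 : b ^ 2 < 1 := by nlinarith
    nlinarith
  have hne : 1 - b ^ 2 * r ^ 2 ≠ 0 := by
    have := (le_abs_self _).trans_lt hx
    linarith
  have g := (((hasSum_coe_mul_geometric_of_norm_lt_one hx).add
    (hasSum_geometric_of_norm_lt_one hx)).mul_left (r ^ 2 * (1 - b ^ 2) ^ 2)).mul_left Real.pi
  have g' : HasSum (fun k : ℕ => Real.pi *
      ((k + 1) * ‖discAutomorphismCoeff b (k + 1)‖ ^ 2 * r ^ (2 * k + 2)))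
      (Real.pi * (r ^ 2 * (1 - b ^ 2) ^ 2 / (1 - b ^ 2 * r ^ 2) ^ 2)) := by
    convert! g using 1
    · ext k
      rw [norm_discAutomorphismCoeff_succ h0 h1]
      ring
    · field_simp
      ring
  rw [← ENNReal.ofReal_tsum_of_nonneg (fun k => by positivity) g'.summable, g'.tsum_eq]

theorem area_discAutomorphism {S : (ℂ → ℂ) → ℝ → ℝ≥0∞} (hS : S = imageArea ∨ S = multiplicityArea)
    (h0 : 0 < b) (h1 : b < 1) {r : ℝ} (hr0 : 0 ≤ r) (hr1 : r < 1) :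
    (S (discAutomorphism b) r).toReal / Real.pi =
      r ^ 2 * (1 - b ^ 2) ^ 2 / (1 - b ^ 2 * r ^ 2) ^ 2 := by
  have hm : S (discAutomorphism b) r = multiplicityArea (discAutomorphism b) r := by
    rcases hS with rfl | rfl
    · exact imageArea_eq_multiplicityArea
        (isBoundedAnalytic_discAutomorphism h0 h1).differentiableOn hr1.le
        ((injOn_discAutomorphism h0 h1).mono (Metric.ball_subset_ball hr1.le))
    · rfl
  rw [hm, multiplicityArea_discAutomorphism h0 h1 hr0 hr1, ENNReal.toReal_ofReal (by positivity),
    mul_div_cancel_left₀ _ Real.pi_ne_zero]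

end DiscAutomorphism

/-! ### Radii below the critical one, and parameters near one -/

theorem area_toReal_div_pi_le {S : (ℂ → ℂ) → ℝ → ℝ≥0∞}
    (hS : S = imageArea ∨ S = multiplicityArea) {f : ℂ → ℂ} {a : ℕ → ℂ}
    (hf : IsBoundedAnalytic f a) {r R : ℝ} (hR0 : 0 ≤ R) (hrR : r ≤ R) (hR : R ^ 2 ≤ 1 / 2) :
    S f r ≠ ∞ ∧ (S f r).toReal / Real.pi ≤
      R ^ 2 * (1 - ‖a 0‖ ^ 2) ^ 2 / (1 - ‖a 0‖ ^ 2 * R ^ 2) ^ 2 := by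
  have hm : S f r ≤ multiplicityArea f r := by
    rcases hS with rfl | rfl
    · exact imageArea_le_multiplicityArea hf.differentiableOn (by nlinarith)
    · exact le_rfl
  have hle := hm.trans ((multiplicityArea_mono f hrR).trans (hf.multiplicityArea_le hR0 hR))
  refine ⟨ne_top_of_le_ne_top ENNReal.ofReal_ne_top hle, ?_⟩
  rw [div_le_iff₀' Real.pi_pos]
  exact ENNReal.toReal_le_of_le_ofReal (by positivity) hle

/-- Sharpness is read off at the parameter `1`, which is not itself admissible (the automorphism
degenerates to a constant), and then holds for parameters slightly below `1`. -/
theorem exists_mem_Ioo_pos_of_continuousAt {F : ℝ → ℝ} (hF : ContinuousAt F 1) (h : 0 < F 1) :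
    ∃ b : ℝ, 0 < b ∧ b < 1 ∧ 0 < F b := by
  have h1 : ∀ᶠ b in nhdsWithin (1 : ℝ) (Set.Iio 1), 0 < F b :=
    (hF.eventually (lt_mem_nhds h)).filter_mono nhdsWithin_le_nhds
  obtain ⟨b, hb, h2⟩ := (h1.and (Ioo_mem_nhdsLT (zero_lt_one' ℝ))).exists
  exact ⟨b, h2.1, h2.2, hb⟩

theorem sum_norm_mul_pow_mono {a : ℕ → ℂ} {r R B : ℝ} (h0 : 0 ≤ r) (h : r ≤ R)
    (hB : ∀ n, ∑ k ∈ Finset.range n, ‖a (k + 1)‖ * R ^ (k + 1) ≤ B) (n : ℕ) :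
    ∑ k ∈ Finset.range n, ‖a (k + 1)‖ * r ^ (k + 1) ≤ B :=
  (Finset.sum_le_sum fun k _ => by gcongr).trans (hB n)

theorem theorem3 (S : (ℂ → ℂ) → ℝ → ℝ≥0∞) (hS : S = imageArea ∨ S = multiplicityArea) :
    -- the first inequality, for `r ≤ 1/3`
    (∀ (f : ℂ → ℂ) (a : ℕ → ℂ), IsBoundedAnalytic f a → ∀ r : ℝ, 0 ≤ r → r ≤ 1 / 3 →
      S f r ≠ ∞ ∧ Summable (fun k : ℕ => ‖a k‖ * r ^ k) ∧
      (∑' k : ℕ, ‖a k‖ * r ^ k) + 16 / 9 * ((S f r).toReal / Real.pi) ≤ 1) ∧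
    -- the radius `1/3` cannot be improved
    (∀ r : ℝ, 1 / 3 < r → r < 1 → ∃ (f : ℂ → ℂ) (a : ℕ → ℂ), IsBoundedAnalytic f a ∧
      1 < (∑' k : ℕ, ‖a k‖ * r ^ k) + 16 / 9 * ((S f r).toReal / Real.pi)) ∧
    -- the constant `16/9` cannot be improved
    (∀ c : ℝ, 16 / 9 < c → ∃ (f : ℂ → ℂ) (a : ℕ → ℂ), IsBoundedAnalytic f a ∧
      1 < (∑' k : ℕ, ‖a k‖ * (1 / 3 : ℝ) ^ k) + c * ((S f (1 / 3)).toReal / Real.pi)) ∧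
    -- the second inequality, for `r ≤ 1/2`
    (∀ (f : ℂ → ℂ) (a : ℕ → ℂ), IsBoundedAnalytic f a → ∀ r : ℝ, 0 ≤ r → r ≤ 1 / 2 →
      S f r ≠ ∞ ∧ Summable (fun k : ℕ => ‖a (k + 1)‖ * r ^ (k + 1)) ∧
      ‖a 0‖ ^ 2 + (∑' k : ℕ, ‖a (k + 1)‖ * r ^ (k + 1))
        + 9 / 8 * ((S f r).toReal / Real.pi) ≤ 1) ∧
    -- the radius `1/2` cannot be improved
    (∀ r : ℝ, 1 / 2 < r → r < 1 → ∃ (f : ℂ → ℂ) (a : ℕ → ℂ), IsBoundedAnalytic f a ∧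
      1 < ‖a 0‖ ^ 2 + (∑' k : ℕ, ‖a (k + 1)‖ * r ^ (k + 1))
        + 9 / 8 * ((S f r).toReal / Real.pi)) ∧
    -- the constant `9/8` cannot be improved
    (∀ c : ℝ, 9 / 8 < c → ∃ (f : ℂ → ℂ) (a : ℕ → ℂ), IsBoundedAnalytic f a ∧
      1 < ‖a 0‖ ^ 2 + (∑' k : ℕ, ‖a (k + 1)‖ * (1 / 2 : ℝ) ^ (k + 1))
        + c * ((S f (1 / 2)).toReal / Real.pi)) := by
  refine ⟨?_, ?_, ?_, ?_, ?_, ?_⟩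
  · intro f a hf r h0 h1
    obtain ⟨B, hB, hle⟩ := norm_add_sum_add_area_le_one hf
    obtain ⟨hfin, hA⟩ := area_toReal_div_pi_le hS hf (by norm_num) h1 (by norm_num)
    have hB' := sum_norm_mul_pow_mono h0 h1 hB
    have hs := summable_of_sum_range_le (fun k => by positivity) hB'
    have hs' : Summable fun k : ℕ => ‖a k‖ * r ^ k := (summable_nat_add_iff 1).mp hs
    refine ⟨hfin, hs', ?_⟩
    rw [hs'.tsum_eq_zero_add, pow_zero, mul_one]
    linarith [Real.tsum_le_of_sum_range_le (fun k => by positivity) hB']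
  · intro r hr hr1
    obtain ⟨b, h0, h1, hb⟩ := exists_mem_Ioo_pos_of_continuousAt
      (F := fun b => r * (1 + 2 * b) - 1) (by fun_prop) (by linarith)
    refine ⟨_, _, isBoundedAnalytic_discAutomorphism h0 h1, ?_⟩
    rw [tsum_discAutomorphismCoeff h0 h1 (by linarith) hr1,
      area_discAutomorphism hS h0 h1 (by linarith) hr1]
    have hrb : 0 < 1 - r * b := by nlinarith
    have hne := hrb.ne'
    have e : b + r * (1 - b ^ 2) / (1 - r * b) - 1 =
        (1 - b) * (r * (1 + 2 * b) - 1) / (1 - r * b) := by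
      rw [eq_div_iff hne, sub_mul, add_mul, div_mul_cancel₀ _ hne]
      ring
    have h2 : 0 < (1 - b) * (r * (1 + 2 * b) - 1) / (1 - r * b) :=
      div_pos (mul_pos (by linarith) hb) hrb
    have h3 : 0 ≤ r ^ 2 * (1 - b ^ 2) ^ 2 / (1 - b ^ 2 * r ^ 2) ^ 2 := by positivity
    linarith
  · intro c hc
    obtain ⟨b, h0, h1, hb⟩ := exists_mem_Ioo_pos_of_continuousAt
      (F := fun b => 9 * c * (1 + b) ^ 2 - 2 * (3 - b) * (3 + b) ^ 2) (by fun_prop)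
      (by linarith)
    refine ⟨_, _, isBoundedAnalytic_discAutomorphism h0 h1, ?_⟩
    rw [tsum_discAutomorphismCoeff h0 h1 (by norm_num) (by norm_num),
      area_discAutomorphism hS h0 h1 (by norm_num) (by norm_num)]
    have h2 : 0 < 3 - b := by linarith
    have h3 : 0 < 3 + b := by linarith
    have e : b + 1 / 3 * (1 - b ^ 2) / (1 - 1 / 3 * b) +
        c * ((1 / 3) ^ 2 * (1 - b ^ 2) ^ 2 / (1 - b ^ 2 * (1 / 3) ^ 2) ^ 2) - 1 =
        (1 - b) ^ 2 * (9 * c * (1 + b) ^ 2 - 2 * (3 - b) * (3 + b) ^ 2) /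
          ((3 - b) ^ 2 * (3 + b) ^ 2) := by
      rw [show 1 - b ^ 2 * (1 / 3) ^ 2 = (3 - b) * (3 + b) / 9 by ring,
        show 1 - 1 / 3 * b = (3 - b) / 3 by ring]
      field_simp
      ring
    have h4 : 0 < (1 - b) ^ 2 * (9 * c * (1 + b) ^ 2 - 2 * (3 - b) * (3 + b) ^ 2) /
          ((3 - b) ^ 2 * (3 + b) ^ 2) :=
      div_pos (mul_pos (pow_pos (by linarith) 2) hb) (by positivity)
    linarith
  · intro f a hf r h0 h1
    obtain ⟨B, hB, hle⟩ := norm_sq_add_sum_add_area_le_one hf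
    obtain ⟨hfin, hA⟩ := area_toReal_div_pi_le hS hf (by norm_num) h1 (by norm_num)
    have hB' := sum_norm_mul_pow_mono h0 h1 hB
    refine ⟨hfin, summable_of_sum_range_le (fun k => by positivity) hB', ?_⟩
    linarith [Real.tsum_le_of_sum_range_le (fun k => by positivity) hB']
  · intro r hr hr1
    obtain ⟨b, h0, h1, hb⟩ := exists_mem_Ioo_pos_of_continuousAt
      (F := fun b => r * (1 + b) - 1) (by fun_prop) (by linarith)
    refine ⟨_, _, isBoundedAnalytic_discAutomorphism h0 h1, ?_⟩
    rw [norm_discAutomorphismCoeff_zero h0,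
      (hasSum_discAutomorphismCoeff_succ h0 h1 (by linarith) hr1).tsum_eq,
      area_discAutomorphism hS h0 h1 (by linarith) hr1]
    have hrb : 0 < 1 - r * b := by nlinarith
    have hne := hrb.ne'
    have e : b ^ 2 + r * (1 - b ^ 2) / (1 - r * b) - 1 =
        (1 - b ^ 2) * (r * (1 + b) - 1) / (1 - r * b) := by
      rw [eq_div_iff hne, sub_mul, add_mul, div_mul_cancel₀ _ hne]
      ring
    have h2 : 0 < (1 - b ^ 2) * (r * (1 + b) - 1) / (1 - r * b) :=
      div_pos (mul_pos (by nlinarith) hb) hrb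
    have h3 : 0 ≤ r ^ 2 * (1 - b ^ 2) ^ 2 / (1 - b ^ 2 * r ^ 2) ^ 2 := by positivity
    linarith
  · intro c hc
    obtain ⟨b, h0, h1, hb⟩ := exists_mem_Ioo_pos_of_continuousAt
      (F := fun b => 4 * c * (1 + b) - (2 - b) * (2 + b) ^ 2) (by fun_prop) (by linarith)
    refine ⟨_, _, isBoundedAnalytic_discAutomorphism h0 h1, ?_⟩
    rw [norm_discAutomorphismCoeff_zero h0,
      (hasSum_discAutomorphismCoeff_succ h0 h1 (by norm_num) (by norm_num)).tsum_eq,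
      area_discAutomorphism hS h0 h1 (by norm_num) (by norm_num)]
    have h2 : 0 < 2 - b := by linarith
    have h3 : 0 < 2 + b := by linarith
    have e : b ^ 2 + 1 / 2 * (1 - b ^ 2) / (1 - 1 / 2 * b) +
        c * ((1 / 2) ^ 2 * (1 - b ^ 2) ^ 2 / (1 - b ^ 2 * (1 / 2) ^ 2) ^ 2) - 1 =
        (1 - b) * (1 - b ^ 2) * (4 * c * (1 + b) - (2 - b) * (2 + b) ^ 2) /
          ((2 - b) ^ 2 * (2 + b) ^ 2) := by
      rw [show 1 - b ^ 2 * (1 / 2) ^ 2 = (2 - b) * (2 + b) / 4 by ring,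
        show 1 - 1 / 2 * b = (2 - b) / 2 by ring]
      field_simp
      ring
    have h4 : 0 < (1 - b) * (1 - b ^ 2) * (4 * c * (1 + b) - (2 - b) * (2 + b) ^ 2) /
          ((2 - b) ^ 2 * (2 + b) ^ 2) :=
      div_pos (mul_pos (mul_pos (by linarith) (by nlinarith)) hb) (by positivity)
    linarith
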